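/- For a simplicial set $X$ and a simplicial set $A$, let $A^X$ denote the internal hom in the cartesian closed category of simplicial sets, and let $h\colon \mathbf{sSet}\to\mathbf{Cat}$ be the homotopy category functor, the left adjoint of the nerve. A quasi-category is a simplicial set with the right lifting property against all inner horn inclusions $\Lambda^{n,k}\hookrightarrow\Delta^n$ ($n\ge 2$, $0<k<n$), and a functor between quasi-categories is a simplicial map. A simplicial map $w\colon X\to Y$ is a weak equivalence in the Joyal model structure if and only if, for every quasi-category $A$, the functor $h(A^w)\colon h(A^Y)\to h(A^X)$ is an equivalence of categories; this is taken as the definition. Let $\mathbf{qCat}_2$ be the 2-category whose objects are the quasi-categories and whose hom-category from $A$ to $B$ is $h(B^A)$, with composition induced by that of internal homs (so its 1-cells are the functors of quasi-categories). A 1-cell $u\colon A\to B$ of a 2-category is an equivalence if there are a 1-cell $v\colon B\to A$ and invertible 2-cells $uv\cong\mathrm{id}_B$ and $vu\cong\mathrm{id}_A$. Let $f\colon A\to B$ be a functor between quasi-categories. Then $f$ is a weak equivalence in the Joyal model structure if and only if $f$ is an equivalence in the 2-category $\mathbf{qCat}_2$. -/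

import Mathlib

universe u

open CategoryTheory

/-- A 1-cell `f : a ⟶ b` of a bicategory (in particular of a 2-category) is an *equivalence* if
there are a 1-cell `g : b ⟶ a` and invertible 2-cells `g ≫ f ≅ 𝟙 b` and `f ≫ g ≅ 𝟙 a`, that is,
isomorphisms in the hom-categories from `b` to `b` and from `a` to `a`. -/
def CategoryTheory.Bicategory.IsEquivalenceOneCell {C : Type*} [Bicategory C] {a b : C}
    (f : a ⟶ b) : Prop :=
  ∃ g : b ⟶ a,
    Nonempty (@Iso (b ⟶ b) (Bicategory.homCategory b b) (g ≫ f) (𝟙 b)) ∧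
    Nonempty (@Iso (a ⟶ a) (Bicategory.homCategory a a) (f ≫ g) (𝟙 a))

/-- The weak equivalences of the Joyal model structure on simplicial sets: the maps `w : X ⟶ Y`
such that, for every quasi-category `A`, restriction along `w` between the internal homs,
`A ^ w : A ^ Y ⟶ A ^ X`, induces an equivalence of homotopy categories `h(A ^ Y) ⥤ h(A ^ X)`.
Here `(MonoidalClosed.pre w).app A` is `A ^ w` in the cartesian closed category `SSet`,
and `hoFunctor`, the left adjoint of the nerve, is `h`. -/
def SSet.joyalWeakEquivalences : MorphismProperty SSet.{u} := fun _ _ w =>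
  ∀ (A : SSet.{u}) [SSet.Quasicategory A],
    (SSet.hoFunctor.map ((MonoidalClosed.pre w).app A)).toFunctor.IsEquivalence

/-- A functor between quasi-categories (a map of simplicial sets), as a 1-cell of the 2-category
`QCat` of quasi-categories, whose hom-category from `A` to `B` is `h(B ^ A)`. -/
def SSet.QCat.oneCell {A B : SSet.{u}} [hA : SSet.Quasicategory A] [hB : SSet.Quasicategory B]
    (f : A ⟶ B) :
    @Quiver.Hom SSet.QCat.{u} SSet.QCat.bicategory.toQuiver ⟨A, hA⟩ ⟨B, hB⟩ :=
  ObjectProperty.homMk f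

/-! A Yoneda argument: a 1-cell is an equivalence exactly when precomposition with it is an
equivalence on every hom-category. In `QCat` the enrichment is transported from simplicial sets
along the lax monoidal functor `hoFunctor`, so precomposition with `f` into `C` is, up to
equivalences of hom-categories, `hoFunctor` applied to restriction `C ^ B ⟶ C ^ A`. The Yoneda
criterion then becomes the definition of a Joyal weak equivalence. -/

namespace CategoryTheory

namespace Bicategory

variable {B : Type*} [Bicategory B] {a b : B}

/-- Precomposition with `f` followed by precomposition with `g` is isomorphic to the identity
as soon as `g ≫ f` is isomorphic to the identity. -/
def precompCompPrecompIso {f : a ⟶ b} {g : b ⟶ a} (e : g ≫ f ≅ 𝟙 b) (c : B) :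
    precomp c f ⋙ precomp c g ≅ 𝟭 (b ⟶ c) :=
  NatIso.ofComponents (fun x ↦ (α_ g f x).symm ≪≫ whiskerRightIso e x ≪≫ λ_ x)
    (fun {x y} η ↦ by
      change g ◁ f ◁ η ≫ (α_ g f y).inv ≫ e.hom ▷ y ≫ (λ_ y).hom =
        ((α_ g f x).inv ≫ e.hom ▷ x ≫ (λ_ x).hom) ≫ η
      simp only [Category.assoc]
      rw [associator_inv_naturality_right_assoc, whisker_exchange_assoc, leftUnitor_naturality])

/-- A 1-cell of a bicategory is an equivalence if and only if precomposition with it induces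
equivalences between all hom-categories. -/
theorem isEquivalenceOneCell_iff_isEquivalence_precomp (f : a ⟶ b) :
    IsEquivalenceOneCell f ↔ ∀ c : B, (precomp c f).IsEquivalence := by
  constructor
  · rintro ⟨g, ⟨e⟩, ⟨e'⟩⟩ c
    exact (CategoryTheory.Equivalence.mk (precomp c f) (precomp c g) (precompCompPrecompIso e c).symm
      (precompCompPrecompIso e' c)).isEquivalence_functor
  · intro h
    have := h a
    have := h b
    -- Essential surjectivity at `a` gives a one-sided inverse `g`. Full faithfulness at `b` makes
    -- it two-sided, as `f ≫ (g ≫ f) ≅ f ≅ f ≫ 𝟙 b`.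
    let g : b ⟶ a := (precomp a f).objPreimage (𝟙 a)
    let e : f ≫ g ≅ 𝟙 a := (precomp a f).objObjPreimageIso (𝟙 a)
    exact ⟨g, ⟨(precomp b f).preimageIso
      ((α_ f g f).symm ≪≫ whiskerRightIso e f ≪≫ λ_ f ≪≫ (ρ_ f).symm)⟩, ⟨e⟩⟩

end Bicategory

namespace CatEnrichedOrdinary

variable {C : Type*} [Category C] [EnrichedOrdinaryCategory Cat C]

/-- The comparison functor from a hom-category of the bicategory associated to a `Cat`-enriched
ordinary category to the enriched hom. -/
def homFunctor (X Y : CatEnrichedOrdinary C) : (X ⟶ Y) ⥤ (X.toBase ⟶ Y.toBase) where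
  obj f := homEquiv f
  map α := Hom.base α

instance (X Y : CatEnrichedOrdinary C) : (homFunctor X Y).IsEquivalence where
  faithful := ⟨fun h ↦ Hom.ext _ _ h⟩
  full := ⟨fun α ↦ ⟨Hom.mk α, rfl⟩⟩
  essSurj := ⟨fun g ↦ ⟨homEquiv.symm g, ⟨eqToIso (homEquiv.apply_symm_apply g)⟩⟩⟩

/-- Precomposition with a 1-cell, as a functor between enriched homs. -/
def basePrecomp {X Y : CatEnrichedOrdinary C} (f : X ⟶ Y) (Z : CatEnrichedOrdinary C) :
    (Y.toBase ⟶ Z.toBase) ⥤ (X.toBase ⟶ Z.toBase) :=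
  (eHomWhiskerRight Cat f Z).toFunctor

lemma basePrecomp_map {X Y Z : CatEnrichedOrdinary C} (f : X ⟶ Y)
    {g h : Y.toBase ⟶ Z.toBase} (η : g ⟶ h) :
    (basePrecomp f Z).map η = CatEnriched.hComp (𝟙 (homEquiv f)) η := by
  -- Whiskering inserts the image of an identity under the functor from the unit category that picks
  -- out `f`.
  exact congrArg (fun α ↦ CatEnriched.hComp (f := homEquiv f) (f' := homEquiv f) α η)
    ((eHomEquiv Cat f).toFunctor.map_id _)

/-- The comparison functors intertwine precomposition in the bicategory with
precomposition between enriched homs. -/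
def precompCompHomFunctorIso {X Y : CatEnrichedOrdinary C} (f : X ⟶ Y)
    (Z : CatEnrichedOrdinary C) :
    Bicategory.precomp Z f ⋙ homFunctor X Z ≅ homFunctor Y Z ⋙ basePrecomp f Z :=
  NatIso.ofComponents (fun g ↦ eqToIso (homEquiv_comp f g)) (fun {g h} η ↦ by
    change (eqToHom (homEquiv_comp f g) ≫ CatEnriched.hComp (𝟙 (homEquiv f)) (Hom.base η) ≫
      eqToHom (homEquiv_comp f h).symm) ≫ eqToHom (homEquiv_comp f h) =
        eqToHom (homEquiv_comp f g) ≫ (basePrecomp f Z).map (Hom.base η)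
    rw [basePrecomp_map]
    simp only [Category.assoc, eqToHom_trans, eqToHom_refl]
    exact congrArg (_ ≫ ·) (Category.comp_id _))

/-- Precomposition with a 1-cell is an equivalence of hom-categories if and only if enriched
precomposition is an equivalence. -/
theorem isEquivalence_precomp_iff {X Y : CatEnrichedOrdinary C} (f : X ⟶ Y)
    (Z : CatEnrichedOrdinary C) :
    (Bicategory.precomp Z f).IsEquivalence ↔
      (eHomWhiskerRight Cat f Z).toFunctor.IsEquivalence := by
  change _ ↔ (basePrecomp f Z).IsEquivalence
  have e := precompCompHomFunctorIso f Z
  constructor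
  · intro _
    have := Functor.isEquivalence_of_iso e
    exact Functor.isEquivalence_of_comp_left (homFunctor Y Z) _
  · intro _
    have := Functor.isEquivalence_of_iso e.symm
    exact Functor.isEquivalence_of_comp_right _ (homFunctor X Z)

end CatEnrichedOrdinary

section

open MonoidalCategory Functor.LaxMonoidal

/-- Enriched precomposition for a transported enrichment is the image of enriched precomposition
under the transport functor. -/
lemma TransportEnrichment.eHomWhiskerRight_eq {V W : Type*} [Category V] [MonoidalCategory V]
    [Category W] [MonoidalCategory W] (F : V ⥤ W) [F.LaxMonoidal]
    {C : Type*} [Category C] [EnrichedOrdinaryCategory V C]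
    (e : ∀ v : V, (𝟙_ V ⟶ v) ≃ (𝟙_ W ⟶ F.obj v))
    (h : ∀ v : V, ∀ f : 𝟙_ V ⟶ v, e v f = ε F ≫ F.map f) {X Y : C} (f : X ⟶ Y) (Z : C) :
    letI := TransportEnrichment.enrichedOrdinaryCategory C F e h
    eHomWhiskerRight (C := TransportEnrichment F C) W f Z = F.map (eHomWhiskerRight V f Z) := by
  change (λ_ _).inv ≫ e _ (eHomEquiv V f) ▷ F.obj _ ≫ μ F _ _ ≫ F.map (eComp V X Y Z) = _
  -- By `h` the unit map factors through `ε F`; naturality of `μ` and left unitality then absorb `ε`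
  -- and `μ`, leaving a composite inside `F`.
  rw [h, comp_whiskerRight, Category.assoc, μ_natural_left_assoc,
    left_unitality_inv_assoc, ← F.map_comp, ← F.map_comp]
  rfl

end

end CategoryTheory

namespace SSet

/-- Precomposition in the simplicial category of simplicial sets is precomposition for the
internal homs of the cartesian closed structure. -/
lemma eHomWhiskerRight_eq_pre {A B : SSet.{u}} (f : A ⟶ B) (C : SSet.{u}) :
    eHomWhiskerRight SSet f C = (MonoidalClosed.pre f).app C := by
  refine MonoidalClosed.uncurry_injective (Eq.trans ?_ (MonoidalClosed.uncurry_pre f C).symm)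
  ext n x
  rfl

/-- Precomposition in the `Cat`-enriched category of quasi-categories is obtained by applying
the homotopy category functor to precomposition of simplicial internal homs. -/
lemma QCat.eHomWhiskerRight_eq {A B : QCat.{u}} (f : A ⟶ B) (C : QCat.{u}) :
    eHomWhiskerRight Cat f C =
      hoFunctor.map (eHomWhiskerRight SSet f.hom C.obj) :=
  TransportEnrichment.eHomWhiskerRight_eq hoFunctor.{u}
    (hoFunctor.unitHomEquiv · |>.trans <| Functor.equivCatHom _ _)
    (congrArg (Functor.toCatHom) <| hoFunctor.unitHomEquiv_eq · ·) f C

end SSet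

theorem mainTheorem5 {A B : SSet.{u}} [SSet.Quasicategory A] [SSet.Quasicategory B] (f : A ⟶ B) :
    SSet.joyalWeakEquivalences f ↔ Bicategory.IsEquivalenceOneCell (SSet.QCat.oneCell f) := by
  rw [Bicategory.isEquivalenceOneCell_iff_isEquivalence_precomp]
  have key (C : SSet.QCat.{u}) : (Bicategory.precomp C (SSet.QCat.oneCell f)).IsEquivalence ↔
      (SSet.hoFunctor.map ((MonoidalClosed.pre f).app C.obj)).toFunctor.IsEquivalence := by
    rw [← SSet.eHomWhiskerRight_eq_pre]
    refine (CatEnrichedOrdinary.isEquivalence_precomp_iff (C := SSet.QCat.{u})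
      (SSet.QCat.oneCell f) C).trans ?_
    exact iff_of_eq (congrArg (fun F ↦ F.toFunctor.IsEquivalence)
      (SSet.QCat.eHomWhiskerRight_eq (SSet.QCat.oneCell f) C))
  simp only [key]
  exact ⟨fun h C ↦ have := C.property; h C.obj, fun h C hC ↦ h ⟨C, hC⟩⟩
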